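/- Let $\mathcal{E}$ be an elementary topos with countable colimits, with chosen finite products, exponentials and a subobject classifier $\Omega$. The types of its internal language are the objects of $\mathcal{E}$, the product type $A\times B$ being the chosen product and the power type $\mathcal{P}A$ the exponential $\Omega^A$. Terms are built from variables, $\ast$, pairs, projections, application of morphisms of $\mathcal{E}$ and comprehension $\{x:A\mid p\}$. Formulas are built from $\top$, $\bot$, subobjects $R(t)$, equations $t=s$, membership $t\in T$, the connectives $\wedge,\vee,\Rightarrow$, countable disjunctions, and the quantifiers $\forall,\exists$. A term $t:B$ in a context $\Delta=(x_1:A_1,\dots,x_k:A_k)$ is interpreted as usual by a morphism $[\![\Delta.\,t]\!]:A_1\times\dots\times A_k\to B$, and a formula $p$ by a subobject $[\![\Delta.\,p]\!]$ of $A_1\times\dots\times A_k$. Let $n\ge 1$, let $A_1,\dots,A_n$ be objects of $\mathcal{E}$, and put $\prod_{i=1}^n\mathcal{P}A_i:=(\cdots(\mathcal{P}A_1\times\mathcal{P}A_2)\times\cdots)\times\mathcal{P}A_n$. For a variable $a:A$ let $\{a\}:=\{a':A\mid a'=a\}$ and let $\varnothing_A:=\{a:A\mid\bot\}$, both terms of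 type $\mathcal{P}A$. For $1\le i\le n$ and a variable $a_i:A_i$ let $$\iota_{a_i}:=\langle\cdots\langle\varnothing_{A_1},\dots\rangle,\{a_i\}\rangle,\dots\rangle,\varnothing_{A_n}\rangle:\prod_{j=1}^n\mathcal{P}A_j$$ be the iterated pair with $\{a_i\}$ in slot $i$ and $\varnothing_{A_j}$ in every slot $j\neq i$. Consider the formula with free variable $z:\prod_{i=1}^n\mathcal{P}A_i$ $$(A_1\textstyle\coprod\cdots\coprod A_n)(z):=(\exists a_1:A_1,\ z=\iota_{a_1})\vee\cdots\vee(\exists a_n:A_n,\ z=\iota_{a_n}),$$ and the subobject $S:=[\![z.\,(A_1\coprod\cdots\coprod A_n)(z)]\!]$ of $\prod_{i=1}^n\Omega^{A_i}$ which interprets it. Then each morphism $[\![a_i:A_i.\,\iota_{a_i}]\!]:A_i\to\prod_{j=1}^n\Omega^{A_j}$ factors (uniquely) through $S$, and the object $S$ together with the resulting morphisms $A_i\to S$, $i=1,\dots,n$, is a coproduct of $A_1,\dots,A_n$ in $\mathcal{E}$. -/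

import Mathlib

open CategoryTheory CategoryTheory.Limits MonoidalCategory CartesianMonoidalCategory

universe v u

namespace InternalLanguage

/-! ### The internal language of a topos: syntax

A topos is a category `C` with finite limits, chosen finite products
(`CartesianMonoidalCategory C`), chosen exponentials (`MonoidalClosed C`) and a chosen subobject
classifier `c : Subobject.Classifier C`.  The types of the language are the objects of `C`: the
product type of `A` and `B` is the chosen product `A ⊗ B`, the unit type is the terminal object
`𝟙_ C`, and the power type of `A` is the chosen exponential `Ω ^ A`. -/

section Language

variable {C : Type u} [Category.{v} C] [CartesianMonoidalCategory C] [MonoidalClosed C]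

/-- The power type `P A`, that is, the exponential `Ω ^ A`. -/
abbrev Pow (c : Subobject.Classifier C) (A : C) : C := (ihom A).obj c.Ω

/-- `Var Γ A` is the type of variables of type `A` occurring in the context `Γ`.  A context is the
finite list of the types of its variables, the most recently added variable being the head. -/
inductive Var : List C → C → Type u
  | zero {Γ : List C} {A : C} : Var (A :: Γ) A
  | succ {Γ : List C} {A B : C} (x : Var Γ A) : Var (B :: Γ) A

/- Terms and formulas in context.  Variables are represented by their position in the context, so
that two terms or formulas which differ by the names of bound variables are equal. -/
mutual

/-- `Term c Γ A`: the terms of type `A` for which `Γ` is a suitable context. -/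
inductive Term (c : Subobject.Classifier C) : List C → C → Type (max u v)
  /-- a variable `x : A` -/
  | var {Γ : List C} {A : C} (x : Var Γ A) : Term c Γ A
  /-- the term `∗ : 𝟙` -/
  | star {Γ : List C} : Term c Γ (𝟙_ C)
  /-- `⟨t, s⟩` -/
  | pair {Γ : List C} {A B : C} (t : Term c Γ A) (s : Term c Γ B) : Term c Γ (A ⊗ B)
  /-- `fst(t)` -/
  | fst {Γ : List C} {A B : C} (t : Term c Γ (A ⊗ B)) : Term c Γ A
  /-- `snd(t)` -/
  | snd {Γ : List C} {A B : C} (t : Term c Γ (A ⊗ B)) : Term c Γ B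
  /-- `f t`, for a morphism `f` -/
  | app {Γ : List C} {A B : C} (f : A ⟶ B) (t : Term c Γ A) : Term c Γ B
  /-- `{x : A | p}`; the variable `x` is bound in `p` -/
  | compr {Γ : List C} {A : C} (p : Formula c (A :: Γ)) : Term c Γ (Pow c A)

/-- `Formula c Γ`: the formulas for which `Γ` is a suitable context. -/
inductive Formula (c : Subobject.Classifier C) : List C → Type (max u v)
  /-- `⊤` -/
  | tru {Γ : List C} : Formula c Γ
  /-- `⊥` -/
  | fls {Γ : List C} : Formula c Γ
  /-- `R(t)`, for a subobject `R` -/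
  | rel {Γ : List C} {A : C} (R : Subobject A) (t : Term c Γ A) : Formula c Γ
  /-- `t = s` -/
  | eq {Γ : List C} {A : C} (t s : Term c Γ A) : Formula c Γ
  /-- `t ∈ T` -/
  | mem {Γ : List C} {A : C} (t : Term c Γ A) (T : Term c Γ (Pow c A)) : Formula c Γ
  /-- `p ∧ q` -/
  | and {Γ : List C} (p q : Formula c Γ) : Formula c Γ
  /-- `p ∨ q` -/
  | or {Γ : List C} (p q : Formula c Γ) : Formula c Γ
  /-- `p ⇒ q` -/
  | imp {Γ : List C} (p q : Formula c Γ) : Formula c Γ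
  /-- the countable disjunction of the `p i` -/
  | iOr {Γ : List C} (p : ℕ → Formula c Γ) : Formula c Γ
  /-- `∀ x : A, p` -/
  | all {Γ : List C} {A : C} (p : Formula c (A :: Γ)) : Formula c Γ
  /-- `∃ x : A, p` -/
  | ex {Γ : List C} {A : C} (p : Formula c (A :: Γ)) : Formula c Γ

end

end Language

/-! ### Operations on subobjects -/

section Subobjects

variable {C : Type u} [Category.{v} C]

/-- The image of `f : X ⟶ Y`: the equalizer of the two inclusions `Y ⇉ Y ⊔_X Y`. -/
noncomputable def imageSub [HasFiniteLimits C] [HasPushouts C] {X Y : C} (f : X ⟶ Y) :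
    Subobject Y :=
  equalizerSubobject (pushout.inl f f) (pushout.inr f f)

/-- The least subobject `0 ↣ X`. -/
noncomputable def botSub [CartesianMonoidalCategory C] [MonoidalClosed C] [HasInitial C] (X : C) :
    Subobject X :=
  Subobject.mk (initial.to X)

/-- The union of two subobjects: the image of the morphism induced on their coproduct. -/
noncomputable def unionSub [HasFiniteLimits C] [HasPushouts C] [HasBinaryCoproducts C] {X : C}
    (S T : Subobject X) : Subobject X :=
  imageSub (coprod.desc S.arrow T.arrow)

/-- The union of a sequence of subobjects: the image of the morphism induced on their coproduct. -/
noncomputable def iUnionSub [HasFiniteLimits C] [HasPushouts C] [HasCountableCoproducts C] {X : C}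
    (S : ℕ → Subobject X) : Subobject X :=
  imageSub (Sigma.desc fun i => (S i).arrow)

/-- The Heyting implication of subobjects, as the equalizer of the characteristic morphisms of
`S ⊓ T` and of `S`. -/
noncomputable def impSub [HasFiniteLimits C] (c : Subobject.Classifier C) {X : C}
    (S T : Subobject X) : Subobject X :=
  equalizerSubobject (c.χ (S ⊓ T).arrow) (c.χ S.arrow)

end Subobjects

/-! ### The interpretation of the internal language -/

section Interpretation

variable {C : Type u} [Category.{v} C] [CartesianMonoidalCategory C]

/-- The interpretation of a context: the product of its types.  A context with a single variable
is interpreted by the type of this variable. -/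
@[reducible] def ctx : List C → C
  | [] => 𝟙_ C
  | [A] => A
  | A :: B :: Γ => A ⊗ ctx (B :: Γ)

/-- The projection onto the most recently added variable. -/
def ctxHead {A : C} : (Γ : List C) → (ctx (A :: Γ) ⟶ A)
  | [] => 𝟙 A
  | B :: Γ => fst A (ctx (B :: Γ))

/-- The projection omitting the most recently added variable. -/
def ctxTail {A : C} : (Γ : List C) → (ctx (A :: Γ) ⟶ ctx Γ)
  | [] => toUnit A
  | B :: Γ => snd A (ctx (B :: Γ))

/-- The canonical isomorphism from `A ⊗ ctx Γ` to `ctx (A :: Γ)`; an identity unless `Γ` is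
empty. -/
def ctxCons {A : C} : (Γ : List C) → (A ⊗ ctx Γ ⟶ ctx (A :: Γ))
  | [] => fst A (𝟙_ C)
  | B :: Γ => 𝟙 (A ⊗ ctx (B :: Γ))

/-- The interpretation of a variable: the projection onto it. -/
def Var.interp : {Γ : List C} → {A : C} → Var Γ A → (ctx Γ ⟶ A)
  | _ :: Γ, _, .zero => ctxHead Γ
  | _ :: Γ, _, .succ x => ctxTail Γ ≫ x.interp

variable [MonoidalClosed C] [HasFiniteLimits C]

/-- The transpose `ctx Γ ⟶ Ω ^ A` of the characteristic morphism of a subobject of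
`ctx (A :: Γ)`. -/
noncomputable def comprHom (c : Subobject.Classifier C) {A : C} (Γ : List C)
    (S : Subobject (ctx (A :: Γ))) : ctx Γ ⟶ Pow c A :=
  MonoidalClosed.curry (ctxCons Γ ≫ c.χ S.arrow)

/-- The subobject `∈_A` of `A × Ω ^ A` classified by the evaluation morphism. -/
noncomputable def memSub (c : Subobject.Classifier C) (A : C) : Subobject (A ⊗ Pow c A) :=
  (Subobject.pullback ((ihom.ev A).app c.Ω)).obj (Subobject.mk c.truth)

/-- Universal quantification of subobjects along the projection `ctx (A :: Γ) ⟶ ctx Γ`: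
the part of `ctx Γ` on which the "set" classified by `S` is the whole of `A`. -/
noncomputable def forallSub (c : Subobject.Classifier C) {A : C} (Γ : List C)
    (S : Subobject (ctx (A :: Γ))) : Subobject (ctx Γ) :=
  equalizerSubobject (comprHom c Γ S) (comprHom c Γ ⊤)

variable [HasCountableColimits C]

/- The mutual recursion defining the interpretation of terms and formulas.  Morphisms are wrapped in
`ULift` only because the two result types of a mutual recursion have to live in one universe. -/
mutual

/-- The interpretation of a term; see `Term.interp`. -/
noncomputable def Term.interpAux {c : Subobject.Classifier C} :
    {Γ : List C} → {A : C} → Term c Γ A → ULift.{max u v} (ctx Γ ⟶ A)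
  | _, _, .var x => ⟨x.interp⟩
  | _, _, .star => ⟨toUnit _⟩
  | _, _, .pair t s => ⟨lift t.interpAux.down s.interpAux.down⟩
  | _, _, .fst t => ⟨t.interpAux.down ≫ CartesianMonoidalCategory.fst _ _⟩
  | _, _, .snd t => ⟨t.interpAux.down ≫ CartesianMonoidalCategory.snd _ _⟩
  | _, _, .app f t => ⟨t.interpAux.down ≫ f⟩
  | Γ, _, .compr p => ⟨comprHom c Γ p.interp⟩

/-- The interpretation `⟦Γ . p⟧` of a formula: a subobject of the interpretation of `Γ`. -/
noncomputable def Formula.interp {c : Subobject.Classifier C} :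
    {Γ : List C} → Formula c Γ → Subobject (ctx Γ)
  | _, .tru => ⊤
  | Γ, .fls => botSub (ctx Γ)
  | _, .rel R t => (Subobject.pullback t.interpAux.down).obj R
  | _, .eq t s => equalizerSubobject t.interpAux.down s.interpAux.down
  | _, .mem (A := A) t T =>
      (Subobject.pullback (lift t.interpAux.down T.interpAux.down)).obj (memSub c A)
  | _, .and p q => p.interp ⊓ q.interp
  | _, .or p q => unionSub p.interp q.interp
  | _, .imp p q => impSub c p.interp q.interp
  | _, .iOr p => iUnionSub fun i => (p i).interp
  | Γ, .all p => forallSub c Γ p.interp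
  | Γ, .ex p => imageSub (p.interp.arrow ≫ ctxTail Γ)

end

/-- The interpretation `⟦Γ . t⟧` of a term: a morphism from the interpretation of `Γ` to the type
of `t`. -/
noncomputable def Term.interp {c : Subobject.Classifier C} {Γ : List C} {A : C}
    (t : Term c Γ A) : ctx Γ ⟶ A :=
  t.interpAux.down

end Interpretation

/-! ### The formula describing a finite coproduct -/

section Coproduct

variable {C : Type u} [Category.{v} C] [CartesianMonoidalCategory C] [MonoidalClosed C]
variable (c : Subobject.Classifier C)

/-- The term `{x} = {x' : A | x' = x}`, for a variable `x : A`. -/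
def singletonTerm {Γ : List C} {A : C} (x : Var Γ A) : Term c Γ (Pow c A) :=
  .compr (.eq (.var .zero) (.var (.succ x)))

/-- The term `∅_A = {x : A | ⊥}`. -/
def emptyTerm (Γ : List C) (A : C) : Term c Γ (Pow c A) :=
  .compr .fls

/-- The iterated product `(…(P A₁ × P A₂) × …) × P Aₙ`, for a family indexed by `n = m + 1`
elements. -/
def powProd : {m : ℕ} → (Fin (m + 1) → C) → C
  | 0, A => Pow c (A 0)
  | m + 1, A => powProd (fun i : Fin (m + 1) => A i.castSucc) ⊗ Pow c (A (Fin.last (m + 1)))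

/-- The iterated pair `⟨…⟨t₁, t₂⟩, …, tₙ⟩`. -/
def tupleTerm {Γ : List C} : {m : ℕ} → (A : Fin (m + 1) → C) →
    ((i : Fin (m + 1)) → Term c Γ (Pow c (A i))) → Term c Γ (powProd c A)
  | 0, _, t => t 0
  | m + 1, A, t =>
      .pair (tupleTerm (fun i : Fin (m + 1) => A i.castSucc) fun i => t i.castSucc)
        (t (Fin.last (m + 1)))

/-- The term `⟨…⟨∅, …⟩, {x}, …, ∅⟩`, with `{x}` in slot `i` and `∅` in every other slot, for a
variable `x : A i`. -/
def injTerm {Γ : List C} {m : ℕ} (A : Fin (m + 1) → C) (i : Fin (m + 1)) (x : Var Γ (A i)) :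
    Term c Γ (powProd c A) :=
  tupleTerm c A (Function.update (fun j => emptyTerm c Γ (A j)) i (singletonTerm c x))

/-- The iterated disjunction `(…(p₁ ∨ p₂) ∨ …) ∨ pₙ`. -/
def disj {Γ : List C} : {m : ℕ} → (Fin (m + 1) → Formula c Γ) → Formula c Γ
  | 0, p => p 0
  | m + 1, p => .or (disj fun i : Fin (m + 1) => p i.castSucc) (p (Fin.last (m + 1)))

/-- The formula `(A₁ ∐ … ∐ Aₙ)(z)` with the free variable `z : (…(P A₁ × P A₂) × …) × P Aₙ`,
the disjunction over `i` of `∃ aᵢ : Aᵢ, z = ⟨…⟨∅, …⟩, {aᵢ}, …, ∅⟩`. -/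
def coproductFormula {m : ℕ} (A : Fin (m + 1) → C) : Formula c [powProd c A] :=
  disj c fun i => .ex (A := A i) (.eq (.var (.succ .zero)) (injTerm c A i .zero))

variable [HasFiniteLimits C] [HasCountableColimits C]

/-- The subobject `⟦z . (A₁ ∐ … ∐ Aₙ)(z)⟧` of `(…(Ω ^ A₁ × Ω ^ A₂) × …) × Ω ^ Aₙ`. -/
noncomputable def coproductSub {m : ℕ} (A : Fin (m + 1) → C) : Subobject (powProd c A) :=
  (coproductFormula c A).interp

/-- The morphism `⟦aᵢ : Aᵢ . ⟨…⟨∅, …⟩, {aᵢ}, …, ∅⟩⟧` from `Aᵢ` to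
`(…(Ω ^ A₁ × Ω ^ A₂) × …) × Ω ^ Aₙ`. -/
noncomputable def injHom {m : ℕ} (A : Fin (m + 1) → C) (i : Fin (m + 1)) : A i ⟶ powProd c A :=
  (injTerm c (Γ := [A i]) A i .zero).interp

end Coproduct

end InternalLanguage

-- The coproduct `∐ A` exists because countable colimits do, so it suffices to identify it with `S`.
-- Disjunctions and existential quantifiers are interpreted by unions and images, hence `S` is the
-- least subobject through which every `injHom c A i` factors (`coproductSub_le_iff`). If the
-- induced map `∐ A ⟶ powProd c A` is monic, it represents this least subobject
-- (`coproductSub_eq_mk`).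
--
-- Monicity comes from taking the components to be `traceHom A c i`, the restrictions of the
-- equality predicate of `∐ A` to the summands. Cartesian closedness makes `- ⊗ T` compatible with
-- coproducts, so the traces of a point determine its singleton and therefore the point
-- (`eq_of_comp_traceHom_eq`).
--
-- It remains to see that the traces of a point of a summand are its singleton and `∅`. This says
-- that the injections are monic and disjoint, which is read off from `summandHom`, a map prescribed
-- summand by summand.

namespace InternalLanguage

-- Generalized elements, images and unions

section Classifier

variable {C : Type u} [Category.{v} C]

/-- A characteristic morphism is true at a generalized element exactly when the element belongs
to the subobject. -/
theorem comp_χ_eq_true_iff (c : Subobject.Classifier C) {X Z : C} (S : Subobject X) (f : Z ⟶ X) :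
    f ≫ c.χ S.arrow = c.χ₀ Z ≫ c.truth ↔ S.Factors f := by
  constructor
  · intro h
    rw [← (c.isPullback S.arrow).lift_fst f (c.χ₀ Z) h]
    exact Subobject.factors_comp_arrow _
  · intro h
    rw [← S.factorThru_arrow f h, Category.assoc, (c.isPullback S.arrow).w, ← Category.assoc]
    congr 1
    exact Subsingleton.elim _ _

/-- Morphisms to `Ω` are determined by the generalized elements at which they are true. -/
theorem hom_Ω_ext (c : Subobject.Classifier C) [HasPullbacks C] {X : C} {φ ψ : X ⟶ c.Ω}
    (h : ∀ {Z : C} (f : Z ⟶ X), f ≫ φ = c.χ₀ Z ≫ c.truth ↔ f ≫ ψ = c.χ₀ Z ≫ c.truth) :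
    φ = ψ := by
  -- Once `φ` is written as the classifier of a mono `i`, the hypothesis says exactly that `ψ` also
  -- has `i` as its pullback of truth.
  obtain ⟨Z, i, hi, rfl⟩ := c.surjective_χ φ
  symm
  have w : i ≫ ψ = c.χ₀ Z ≫ c.truth := (h i).1 (c.isPullback i).w
  refine c.uniq i (χ₀' := c.χ₀ Z) ⟨⟨w⟩, ⟨PullbackCone.IsLimit.mk _
    (fun s => (c.isPullback i).lift s.fst s.snd ?_) ?_ ?_ ?_⟩⟩
  · have e : s.snd = c.χ₀ _ := Subsingleton.elim _ _
    rw [e]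
    refine (h s.fst).2 ?_
    rw [s.condition, e]
  · intro s
    exact (c.isPullback i).lift_fst _ _ _
  · intro s
    exact Subsingleton.elim _ _
  · intro s l hl _
    rw [← cancel_mono i, hl, (c.isPullback i).lift_fst]

/-- `imageSub f` is the least subobject through which `f` factors. -/
theorem imageSub_le_iff (c : Subobject.Classifier C) [HasFiniteLimits C] [HasPushouts C] {X Y : C} (f : X ⟶ Y)
    (U : Subobject Y) : imageSub f ≤ U ↔ U.Factors f := by
  constructor
  · intro h
    exact Subobject.factors_of_le f h (equalizerSubobject_factors _ _ f pushout.condition)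
  · intro h
    refine Subobject.le_of_factors ((comp_χ_eq_true_iff c U _).1 ?_)
    -- The classifier of `U` and constant truth agree on `f`, so they glue to a map out of the
    -- pushout. Whatever equalizes the two pushout inclusions therefore lies in `U`.
    have h' : f ≫ c.χ U.arrow = f ≫ c.χ₀ Y ≫ c.truth := by
      rw [(comp_χ_eq_true_iff c U f).2 h, ← Category.assoc]
      congr 1
      exact Subsingleton.elim _ _
    have e := (equalizerSubobject_factors_iff (pushout.inl f f) (pushout.inr f f) _).1
      (imageSub f).factors_self
    have e' := congrArg (· ≫ pushout.desc _ _ h') e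
    simp only [Category.assoc, pushout.inl_desc, pushout.inr_desc] at e'
    rw [e', ← Category.assoc]
    congr 1
    exact Subsingleton.elim _ _

theorem unionSub_le_iff (c : Subobject.Classifier C) [HasFiniteLimits C] [HasPushouts C] [HasBinaryCoproducts C] {X : C}
    (S T U : Subobject X) : unionSub S T ≤ U ↔ S ≤ U ∧ T ≤ U := by
  rw [unionSub, imageSub_le_iff c]
  constructor
  · intro h
    constructor
    · refine Subobject.le_of_factors ?_
      rw [← coprod.inl_desc S.arrow T.arrow]
      exact Subobject.factors_of_factors_right _ h
    · refine Subobject.le_of_factors ?_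
      rw [← coprod.inr_desc S.arrow T.arrow]
      exact Subobject.factors_of_factors_right _ h
  · rintro ⟨hS, hT⟩
    have : coprod.desc S.arrow T.arrow =
        coprod.desc (Subobject.ofLE S U hS) (Subobject.ofLE T U hT) ≫ U.arrow := by
      ext <;> simp
    rw [this]
    exact Subobject.factors_comp_arrow _

end Classifier

section Contexts

variable {C : Type u} [Category.{v} C] [CartesianMonoidalCategory C]

theorem ctxCons_ctxHead {A : C} (Γ : List C) : ctxCons (A := A) Γ ≫ ctxHead Γ = fst A (ctx Γ) := by
  cases Γ
  · exact Category.comp_id _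
  · exact Category.id_comp _

theorem ctxCons_ctxTail {A : C} (Γ : List C) : ctxCons (A := A) Γ ≫ ctxTail Γ = snd A (ctx Γ) := by
  cases Γ
  · exact toUnit_unique _ _
  · exact Category.id_comp _

end Contexts

-- Singletons and the empty set

section Singletons

variable {C : Type u} [Category.{v} C] [CartesianMonoidalCategory C] [MonoidalClosed C]

/-- The initial object is strict by cartesian closedness, so all maps out of such a `Z` agree. The
criterion involves only `Z`, whence `∅` is stable under substitution. -/
theorem botSub_factors_iff [HasInitial C] {X Z : C} (f : Z ⟶ X) :
    (botSub X).Factors f ↔ Nonempty (Z ⟶ ⊥_ C) := by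
  rw [botSub, Subobject.mk_factors_iff]
  constructor
  · rintro ⟨g, -⟩
    exact ⟨g⟩
  · rintro ⟨g⟩
    refine ⟨g, ?_⟩
    have := strict_initial initialIsInitial g
    change g ≫ initial.to X = f
    rw [← cancel_epi (inv g)]
    exact initialIsInitial.hom_ext _ _

variable (c : Subobject.Classifier C)

/-- The morphism `a ↦ {a}`. -/
noncomputable def singletonHom [HasFiniteLimits C] (A : C) : A ⟶ Pow c A :=
  MonoidalClosed.curry (c.χ (equalizerSubobject (fst A A) (snd A A)).arrow)

/-- The constant morphism with value `∅`. -/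
noncomputable def emptyHom [HasInitial C] (X A : C) : X ⟶ Pow c A :=
  MonoidalClosed.curry (c.χ (botSub (A ⊗ X)).arrow)

theorem comp_emptyHom [HasPullbacks C] [HasInitial C] {X Y : C} (f : X ⟶ Y) (A : C) :
    f ≫ emptyHom c Y A = emptyHom c X A := by
  rw [emptyHom, emptyHom, ← MonoidalClosed.curry_natural_left]
  congr 1
  refine hom_Ω_ext c fun g => ?_
  rw [← Category.assoc, comp_χ_eq_true_iff, comp_χ_eq_true_iff, botSub_factors_iff,
    botSub_factors_iff]

/-- If `{x}` and the set classified by `φ` at `y` agree, then `x` belongs to the latter. -/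
theorem lift_comp_eq_true_of_singletonHom [HasFiniteLimits C] {A X Y : C} (x : X ⟶ A) (y : X ⟶ Y)
    (φ : A ⊗ Y ⟶ c.Ω) (h : x ≫ singletonHom c A = y ≫ MonoidalClosed.curry φ) :
    lift x y ≫ φ = c.χ₀ X ≫ c.truth := by
  rw [singletonHom, ← MonoidalClosed.curry_natural_left, ← MonoidalClosed.curry_natural_left] at h
  -- Test both sets on the element `x` itself, which lies in `{x}`.
  have e := congrArg (lift x (𝟙 X) ≫ ·) (MonoidalClosed.curry_injective h)
  simp only [lift_whiskerLeft_assoc, Category.id_comp] at e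
  rw [← e, comp_χ_eq_true_iff, equalizerSubobject_factors_iff, lift_fst, lift_snd]

theorem eq_of_comp_singletonHom_eq [HasFiniteLimits C]
    {A X : C} {x y : X ⟶ A}
    (h : x ≫ singletonHom c A = y ≫ singletonHom c A) : x = y := by
  have e := lift_comp_eq_true_of_singletonHom c x y _ h
  rwa [comp_χ_eq_true_iff, equalizerSubobject_factors_iff, lift_fst, lift_snd] at e

theorem nonempty_hom_initial_of_singletonHom [HasFiniteLimits C] [HasInitial C] {A X Y : C}
    (x : X ⟶ A) (y : X ⟶ Y) (h : x ≫ singletonHom c A = y ≫ emptyHom c Y A) :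
    Nonempty (X ⟶ ⊥_ C) := by
  have e := lift_comp_eq_true_of_singletonHom c x y _ h
  rwa [comp_χ_eq_true_iff, botSub_factors_iff] at e

end Singletons

-- Joint monicity of the traces

section Coproducts

variable {C : Type u} [Category.{v} C] [CartesianMonoidalCategory C] [MonoidalClosed C]
variable {ι : Type*} (A : ι → C) [HasCoproduct A]

/-- The functors `- ⊗ T` preserve coproducts, as far as uniqueness is concerned. -/
theorem sigma_tensor_hom_ext {T Y : C} {φ ψ : (∐ A) ⊗ T ⟶ Y}
    (h : ∀ i, Sigma.ι A i ▷ T ≫ φ = Sigma.ι A i ▷ T ≫ ψ) : φ = ψ := by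
  -- Currying acts on `T ⊗ -`, so the factors are swapped by hand.
  let s (X : C) : T ⊗ X ⟶ X ⊗ T := lift (snd T X) (fst T X)
  have hs : lift (snd (∐ A) T) (fst (∐ A) T) ≫ s _ = 𝟙 _ := by
    ext <;> simp [s]
  have key : s (∐ A) ≫ φ = s (∐ A) ≫ ψ := by
    refine MonoidalClosed.curry_injective (Sigma.hom_ext _ _ fun i => ?_)
    have e : T ◁ Sigma.ι A i ≫ s (∐ A) = s (A i) ≫ Sigma.ι A i ▷ T := by
      ext <;> simp [s]
    rw [← MonoidalClosed.curry_natural_left, ← MonoidalClosed.curry_natural_left,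
      reassoc_of% e, reassoc_of% e, h i]
  rw [← Category.id_comp φ, ← Category.id_comp ψ, ← hs, Category.assoc, Category.assoc, key]

/-- The morphism `∐ A ⟶ P (A i)` sending an element to its part in the summand `A i`. -/
noncomputable def traceHom [HasFiniteLimits C] (c : Subobject.Classifier C) (i : ι) :
    ∐ A ⟶ Pow c (A i) :=
  MonoidalClosed.curry
    (Sigma.ι A i ▷ _ ≫ c.χ (equalizerSubobject (fst (∐ A) (∐ A)) (snd (∐ A) (∐ A))).arrow)

/-- The morphisms `traceHom A c i` are jointly monic. -/
theorem eq_of_comp_traceHom_eq [HasFiniteLimits C] (c : Subobject.Classifier C)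
    {T : C} {x y : T ⟶ ∐ A}
    (h : ∀ i, x ≫ traceHom A c i = y ≫ traceHom A c i) : x = y := by
  -- The predicates "equal to `x`" and "equal to `y`" are compared on each summand of the first
  -- variable, where they are the transposes of the traces.
  have key : (∐ A) ◁ x ≫ c.χ (equalizerSubobject (fst (∐ A) (∐ A)) (snd (∐ A) (∐ A))).arrow =
      (∐ A) ◁ y ≫ c.χ (equalizerSubobject (fst (∐ A) (∐ A)) (snd (∐ A) (∐ A))).arrow := by
    refine sigma_tensor_hom_ext A fun i => ?_
    have e := h i
    rw [traceHom, ← MonoidalClosed.curry_natural_left, ← MonoidalClosed.curry_natural_left] at e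
    rw [← whisker_exchange_assoc, ← whisker_exchange_assoc]
    exact MonoidalClosed.curry_injective e
  refine eq_of_comp_singletonHom_eq c ?_
  rw [singletonHom, ← MonoidalClosed.curry_natural_left, ← MonoidalClosed.curry_natural_left, key]

-- Disjointness, and the traces on each summand

section Disjoint

variable [HasFiniteLimits C] [HasInitial C] [DecidableEq ι]

/-- The morphism `∐ A ⟶ P (A i)` sending an element of `A i` to its singleton and an element of
another summand to `∅`. -/
noncomputable def summandHom (c : Subobject.Classifier C) (i : ι) : ∐ A ⟶ Pow c (A i) :=
  Sigma.desc fun j => if h : j = i then eqToHom (by rw [h]) ≫ singletonHom c (A i)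
    else emptyHom c (A j) (A i)

theorem ι_summandHom_self (c : Subobject.Classifier C) (i : ι) :
    Sigma.ι A i ≫ summandHom A c i = singletonHom c (A i) := by
  simp [summandHom]

theorem ι_summandHom_of_ne (c : Subobject.Classifier C) {i j : ι} (h : j ≠ i) :
    Sigma.ι A j ≫ summandHom A c i = emptyHom c (A j) (A i) := by
  simp [summandHom, h]

/-- The coproduct injections are monomorphisms. -/
theorem eq_of_comp_ι_eq (c : Subobject.Classifier C)
    {i : ι} {X : C} {x y : X ⟶ A i} (h : x ≫ Sigma.ι A i = y ≫ Sigma.ι A i) :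
    x = y := by
  have e := congrArg (· ≫ summandHom A c i) h
  simp only [Category.assoc, ι_summandHom_self] at e
  exact eq_of_comp_singletonHom_eq c e

/-- Coproducts are disjoint. -/
theorem nonempty_hom_initial_of_comp_ι_eq (c : Subobject.Classifier C) {i j : ι} (hij : j ≠ i) {X : C} {x : X ⟶ A i}
    {y : X ⟶ A j} (h : x ≫ Sigma.ι A i = y ≫ Sigma.ι A j) : Nonempty (X ⟶ ⊥_ C) := by
  have e := congrArg (· ≫ summandHom A c i) h
  simp only [Category.assoc, ι_summandHom_self, ι_summandHom_of_ne A c hij] at e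
  exact nonempty_hom_initial_of_singletonHom c x y e

/-- Since the injection is monic, equality in `∐ A` of two elements of `A i` is equality in `A i`.
-/
theorem ι_traceHom_self (c : Subobject.Classifier C) (i : ι) : Sigma.ι A i ≫ traceHom A c i = singletonHom c (A i) := by
  rw [traceHom, singletonHom, ← MonoidalClosed.curry_natural_left]
  congr 1
  refine hom_Ω_ext c fun f => ?_
  rw [← Category.assoc, ← Category.assoc, comp_χ_eq_true_iff, comp_χ_eq_true_iff,
    equalizerSubobject_factors_iff, equalizerSubobject_factors_iff]
  simp only [Category.assoc, whiskerRight_fst, whiskerRight_snd, whiskerLeft_fst_assoc,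
    whiskerLeft_snd]
  constructor
  · intro h
    exact eq_of_comp_ι_eq A c (by simpa only [Category.assoc] using h)
  · intro h
    rw [← Category.assoc, h, Category.assoc]

/-- By disjointness, elements of different summands become equal only over an initial domain. -/
theorem ι_traceHom_of_ne (c : Subobject.Classifier C) {i j : ι} (hij : j ≠ i) :
    Sigma.ι A j ≫ traceHom A c i = emptyHom c (A j) (A i) := by
  rw [traceHom, emptyHom, ← MonoidalClosed.curry_natural_left]
  congr 1
  refine hom_Ω_ext c fun f => ?_
  rw [← Category.assoc, ← Category.assoc, comp_χ_eq_true_iff, comp_χ_eq_true_iff,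
    equalizerSubobject_factors_iff, botSub_factors_iff]
  simp only [Category.assoc, whiskerRight_fst, whiskerRight_snd, whiskerLeft_fst_assoc,
    whiskerLeft_snd]
  constructor
  · intro h
    exact nonempty_hom_initial_of_comp_ι_eq A c hij (x := f ≫ fst _ _) (y := f ≫ snd _ _)
      (by simpa only [Category.assoc] using h)
  · rintro ⟨g⟩
    have := strict_initial initialIsInitial g
    rw [← cancel_epi (inv g)]
    exact initialIsInitial.hom_ext _ _

end Disjoint

end Coproducts

-- Interpretation of the formula and comparison with the coproduct

section Tuples

variable {C : Type u} [Category.{v} C] [CartesianMonoidalCategory C] [MonoidalClosed C]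
variable (c : Subobject.Classifier C)

/-- The morphism to `powProd c A` with given components. -/
def tupleHom {X : C} : {m : ℕ} → (A : Fin (m + 1) → C) →
    ((i : Fin (m + 1)) → (X ⟶ Pow c (A i))) → (X ⟶ powProd c A)
  | 0, _, t => t 0
  | m + 1, A, t =>
      lift (tupleHom (fun i : Fin (m + 1) => A i.castSucc) fun i => t i.castSucc)
        (t (Fin.last (m + 1)))

theorem comp_tupleHom {X Y : C} (f : X ⟶ Y) {m : ℕ} (A : Fin (m + 1) → C)
    (t : (i : Fin (m + 1)) → (Y ⟶ Pow c (A i))) :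
    f ≫ tupleHom c A t = tupleHom c A fun i => f ≫ t i := by
  induction m with
  | zero => rfl
  | succ m ih =>
    exact (comp_lift _ _ _).trans (congrArg (fun g => lift g _) (ih _ _))

theorem tupleHom_injective {X : C} {m : ℕ} (A : Fin (m + 1) → C)
    {s t : (i : Fin (m + 1)) → (X ⟶ Pow c (A i))} (h : tupleHom c A s = tupleHom c A t)
    (i : Fin (m + 1)) : s i = t i := by
  induction m with
  | zero =>
    obtain rfl : i = 0 := Fin.fin_one_eq_zero i
    exact h
  | succ m ih =>
    have h₁ := congrArg (· ≫ fst _ _) h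
    have h₂ := congrArg (· ≫ snd _ _) h
    simp only [tupleHom, lift_fst, lift_snd] at h₁ h₂
    induction i using Fin.lastCases with
    | last => exact h₂
    | cast i => exact ih _ h₁ i

variable [HasFiniteLimits C] [HasCountableColimits C]

theorem interp_var {Γ : List C} {A : C} (x : Var Γ A) :
    (Term.var (c := c) x).interp = x.interp := by
  rw [Term.interp, Term.interpAux]

theorem interp_pair {Γ : List C} {A B : C} (t : Term c Γ A) (s : Term c Γ B) :
    (t.pair s).interp = lift t.interp s.interp := by
  rw [Term.interp, Term.interpAux, Term.interp, Term.interp]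

theorem interp_compr {Γ : List C} {A : C} (p : Formula c (A :: Γ)) :
    (Term.compr p).interp = comprHom c Γ p.interp := by
  rw [Term.interp, Term.interpAux]

theorem interp_eq {Γ : List C} {A : C} (t s : Term c Γ A) :
    (Formula.eq t s).interp = equalizerSubobject t.interp s.interp := by
  rw [Formula.interp]
  rfl

theorem interp_ex {Γ : List C} {A : C} (p : Formula c (A :: Γ)) :
    p.ex.interp = imageSub (p.interp.arrow ≫ ctxTail Γ) := by
  rw [Formula.interp]

theorem interp_tupleTerm {Γ : List C} {m : ℕ} (A : Fin (m + 1) → C)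
    (t : (i : Fin (m + 1)) → Term c Γ (Pow c (A i))) :
    (tupleTerm c A t).interp = tupleHom c A fun i => (t i).interp := by
  induction m with
  | zero => rfl
  | succ m ih =>
    exact (interp_pair c _ _).trans (congrArg (fun g => lift g _) (ih _ _))

theorem interp_emptyTerm (Γ : List C) (A : C) :
    (emptyTerm c Γ A).interp = emptyHom c (ctx Γ) A := by
  rw [emptyTerm, interp_compr, Formula.interp, emptyHom]
  refine congrArg MonoidalClosed.curry ?_
  refine hom_Ω_ext c fun f => ?_
  rw [← Category.assoc, comp_χ_eq_true_iff, comp_χ_eq_true_iff, botSub_factors_iff,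
    botSub_factors_iff]

theorem interp_singletonTerm {Γ : List C} {A : C} (x : Var Γ A) :
    (singletonTerm c x).interp = x.interp ≫ singletonHom c A := by
  rw [singletonTerm, interp_compr, interp_eq, interp_var, interp_var, singletonHom, ← MonoidalClosed.curry_natural_left]
  refine congrArg MonoidalClosed.curry ?_
  refine hom_Ω_ext c fun f => ?_
  rw [← Category.assoc, ← Category.assoc, comp_χ_eq_true_iff, comp_χ_eq_true_iff,
    equalizerSubobject_factors_iff, equalizerSubobject_factors_iff]
  simp only [Var.interp, Category.assoc, ctxCons_ctxHead, reassoc_of% ctxCons_ctxTail (A := A) Γ,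
    whiskerLeft_fst, whiskerLeft_snd]

/-- A substitution property: it relates the term under the quantifier, where `z` is also in context,
to `injHom`, whose context is `A i` alone. -/
theorem interp_injTerm {Γ : List C} {m : ℕ} (A : Fin (m + 1) → C) (i : Fin (m + 1))
    (x : Var Γ (A i)) : (injTerm c A i x).interp = x.interp ≫ injHom c A i := by
  rw [injHom, injTerm, injTerm, interp_tupleTerm, interp_tupleTerm, comp_tupleHom]
  congr 1
  funext j
  by_cases h : j = i
  · subst h
    simp only [Function.update_self, interp_singletonTerm]
    exact congrArg (x.interp ≫ ·) (Category.id_comp _).symm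
  · simp only [Function.update_of_ne h, interp_emptyTerm]
    exact (comp_emptyHom c _ _).symm

theorem disj_interp_le_iff {Γ : List C} {m : ℕ} (p : Fin (m + 1) → Formula c Γ)
    (U : Subobject (ctx Γ)) : (disj c p).interp ≤ U ↔ ∀ i, (p i).interp ≤ U := by
  induction m with
  | zero =>
    exact ⟨fun h i => by rwa [Fin.fin_one_eq_zero i], fun h => h 0⟩
  | succ m ih =>
    rw [disj, Formula.interp, unionSub_le_iff c, ih]
    exact ⟨fun h i => Fin.lastCases h.2 h.1 i, fun h => ⟨fun i => h _, h _⟩⟩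

/-- The body of the `i`-th existential is the graph of `injHom c A i`, so its image under projection
to `z` is the image of `injHom c A i`. -/
theorem coproductSub_le_iff {m : ℕ} (A : Fin (m + 1) → C) (U : Subobject (powProd c A)) :
    coproductSub c A ≤ U ↔ ∀ i, U.Factors (injHom c A i) := by
  refine (disj_interp_le_iff c (Γ := [powProd c A]) _ U).trans (forall_congr' fun i => ?_)
  have h₁ : (Var.succ .zero : Var [A i, powProd c A] _).interp = snd (A i) (powProd c A) :=
    Category.comp_id _
  have h₂ : (.zero : Var [A i, powProd c A] _).interp = fst (A i) (powProd c A) := rfl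
  rw [interp_ex, imageSub_le_iff c, interp_eq, interp_var, interp_injTerm, h₁, h₂]
  change U.Factors (_ ≫ snd (A i) (powProd c A)) ↔ _
  constructor
  · intro h
    -- The graph is parametrized by `A i` via `a ↦ (a, ι_a)`.
    have hf := equalizerSubobject_factors (snd (A i) (powProd c A))
      (fst (A i) (powProd c A) ≫ injHom c A i) (lift (𝟙 _) (injHom c A i)) (by simp)
    have e : injHom c A i = Subobject.factorThru _ _ hf ≫
        (equalizerSubobject (snd (A i) (powProd c A))
          (fst (A i) (powProd c A) ≫ injHom c A i)).arrow ≫ snd _ _ := by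
      rw [Subobject.factorThru_arrow_assoc, lift_snd]
    rw [e]
    exact Subobject.factors_of_factors_right _ h
  · intro h
    rw [equalizerSubobject_arrow_comp, ← Category.assoc]
    exact Subobject.factors_of_factors_right _ h

/-- The morphism `∐ A ⟶ powProd c A` sending an element of `A i` to the tuple with its singleton
in slot `i` and `∅` in every other slot. -/
noncomputable def sigmaHom {m : ℕ} (A : Fin (m + 1) → C) : ∐ A ⟶ powProd c A :=
  tupleHom c A (traceHom A c)

theorem ι_sigmaHom {m : ℕ} (A : Fin (m + 1) → C) (i : Fin (m + 1)) :
    Sigma.ι A i ≫ sigmaHom c A = injHom c A i := by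
  rw [sigmaHom, comp_tupleHom, injHom, injTerm, interp_tupleTerm]
  congr 1
  funext j
  by_cases h : j = i
  · subst h
    rw [Function.update_self, interp_singletonTerm, ι_traceHom_self]
    exact (Category.id_comp _).symm
  · rw [Function.update_of_ne h, interp_emptyTerm, ι_traceHom_of_ne A c (Ne.symm h)]

instance mono_sigmaHom {m : ℕ} (A : Fin (m + 1) → C) : Mono (sigmaHom c A) where
  right_cancellation x y h := by
    rw [sigmaHom, comp_tupleHom, comp_tupleHom] at h
    exact eq_of_comp_traceHom_eq A c (tupleHom_injective c A h)

theorem coproductSub_eq_mk {m : ℕ} (A : Fin (m + 1) → C) :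
    coproductSub c A = Subobject.mk (sigmaHom c A) := by
  refine le_antisymm ((coproductSub_le_iff c A _).2 fun i => ?_) ?_
  · rw [← ι_sigmaHom]
    exact Subobject.factors_of_factors_right _ (Subobject.mk_factors_self _)
  · have h := (coproductSub_le_iff c A _).1 le_rfl
    refine Subobject.mk_le_of_comm (Sigma.desc fun i => Subobject.factorThru _ _ (h i)) ?_
    refine Sigma.hom_ext _ _ fun i => ?_
    rw [Sigma.ι_desc_assoc, Subobject.factorThru_arrow, ι_sigmaHom]

end Tuples

end InternalLanguage

theorem mainTheorem3 {C : Type u} [Category.{v} C] [CartesianMonoidalCategory C]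
    [MonoidalClosed C] [HasFiniteLimits C] [HasCountableColimits C]
    (c : Subobject.Classifier C) {m : ℕ} (A : Fin (m + 1) → C) :
    ∃ h : ∀ i, (InternalLanguage.coproductSub c A).Factors (InternalLanguage.injHom c A i),
      Nonempty (IsColimit (Cofan.mk (InternalLanguage.coproductSub c A : C) fun i =>
        (InternalLanguage.coproductSub c A).factorThru (InternalLanguage.injHom c A i) (h i))) := by
  refine ⟨(InternalLanguage.coproductSub_le_iff c A _).1 le_rfl, ⟨?_⟩⟩
  refine IsColimit.ofIsoColimit (coproductIsCoproduct A)
    (Cofan.ext (Subobject.isoOfEqMk _ _ (InternalLanguage.coproductSub_eq_mk c A)).symm fun i => ?_)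
  rw [← cancel_mono (InternalLanguage.coproductSub c A).arrow]
  simp [InternalLanguage.ι_sigmaHom]
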